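/- Let $c>0$ and $\mu\in\mathbb R$. (1) Let $q,p$ be a canonical pair of fields on $\mathbb R^3$ in a complex Hilbert space $\mathcal H$: for every real Schwartz function $f$ on $\mathbb R^3$ there are self-adjoint operators $q(f)=\int f(x)q(x)\,dx$ and $p(f)=\int f(x)p(x)\,dx$ in $\mathcal H$, all defined on, and leaving invariant, a common dense subspace $D$. On $D$ they are real-linear in $f$, their matrix elements between vectors of $D$ are tempered distributions in $f$, and $$[q(f),p(g)]=i\int fg\,dx,\qquad [q(f),q(g)]=[p(f),p(g)]=0 ,$$ i.e. $[q(x),p(x')]=i\delta(x-x')$, $[q(x),q(x')]=[p(x),p(x')]=0$. Let $H$ be a self-adjoint operator with $D\subset\operatorname{dom}H$ such that on $D$ $$H=\frac12\int_{\mathbb R^3}\bigl(p(x)^2+c^2|\nabla q(x)|^2+c^4\mu^2q(x)^2\bigr)\,dx ,$$ in the following renormalized sense: for some sequence of smooth approximate identities $\rho_n\ge0$ ($\int\rho_n=1$, supports shrinking to $0$) and some real constants $e_n$, with $p_n(x)=p(\rho_n(\cdot-x))$ and $q_n(x)=q(\rho_n(\cdot-x))$, the matrix elements $\langle\varphi,\{\frac12(p_n(x)^2+c^2|\nabla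 q_n(x)|^2+c^4\mu^2q_n(x)^2)-e_n\}\psi\rangle$ are integrable in $x$ and their integrals converge to $\langle\varphi,H\psi\rangle$ as $n\to\infty$, for all $\varphi,\psi\in D$. Suppose $e^{-itH}D\subset D$ for all $t\in\mathbb R$, and that for $\psi\in D$ the vectors $q(f,t)\psi$ and $p(f,t)\psi$ are continuous in $t$, where $$q(f,t)=e^{itH}q(f)e^{-itH},\qquad p(f,t)=e^{itH}p(f)e^{-itH}.$$ Then on $D$, with derivatives in $t$ taken in the norm of $\mathcal H$ after application to any vector of $D$, and with $\Delta q$ understood as a distribution, $(\Delta q)(f,t)=q(\Delta f,t)$, for every real Schwartz function $f$ and all $t$, $$\frac{\partial q}{\partial t}(f,t)=p(f,t),\qquad \frac{\partial p}{\partial t}(f,t)=(c^2\Delta q-c^4\mu^2q)(f,t),$$ and therefore $q$ is twice differentiable in $t$ and satisfies the Klein-Gordon equation $$\Bigl(\frac1{c^2}\frac{\partial^2}{\partial t^2}-\Delta+c^2\mu^2\Bigr)q=0 .$$ (2) The Klein-Gordon equation also follows from the first-order equation. Let $D$ be any subspace of a complex Hilbert space $\mathcal H$, let $\mathcal T$ be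 the space of all $f+\sqrt{-\Delta+c^2\mu^2}\,g$ with $f,g$ complex Schwartz functions on $\mathbb R^3$ (for $\mu\ne0$ this is the Schwartz space), where $\sqrt{-\Delta+c^2\mu^2}$ is defined by the Fourier transform, and let $q(f,t)$ $(f\in\mathcal T,\ t\in\mathbb R)$ be linear operators from $D$ to $\mathcal H$ depending linearly on $f$. If $q(f,t)$ is differentiable in $t$ on $D$ and $$\frac1i\frac{\partial q}{\partial t}+c\sqrt{-\Delta+c^2\mu^2}\;q=0$$ (that is, $\frac1i\partial_tq(f,t)+c\,q(\sqrt{-\Delta+c^2\mu^2}f,t)=0$ for all $f\in\mathcal T$), then $q$ satisfies the Klein-Gordon equation, tested against all complex Schwartz functions. -/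

import Mathlib

open scoped SchwartzMap FourierTransform Laplacian LineDeriv InnerProductSpace
open MeasureTheory Filter Topology

namespace ScalarField

noncomputable section

/-- Physical space `ℝ³`, with its Euclidean norm. -/
abbrev Space : Type := EuclideanSpace ℝ (Fin 3)

/-- The real Schwartz functions on `ℝ³`, against which the fields are smeared. -/
abbrev Test : Type := 𝓢(Space, ℝ)

section Operators

variable {𝓗 : Type*} [NormedAddCommGroup 𝓗] [InnerProductSpace ℂ 𝓗]

/-- The restriction to a subspace `D` of an unbounded operator whose domain contains `D`. -/
def restrictTo (A : 𝓗 →ₗ.[ℂ] 𝓗) {D : Submodule ℂ 𝓗} (h : D ≤ A.domain) : D →ₗ[ℂ] 𝓗 :=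
  A.toFun ∘ₗ Submodule.inclusion h

/-- `A'` is the time derivative of the time-dependent operator `A` on `D`: for every `ψ ∈ D` the
vector `A t ψ` is differentiable in `t`, in the norm of `𝓗`, with derivative `A' t ψ`. -/
def IsTimeDeriv {D : Submodule ℂ 𝓗} (A A' : ℝ → D →ₗ[ℂ] 𝓗) : Prop :=
  ∀ (ψ : D) (t : ℝ), HasDerivAt (fun s => A s ψ) (A' t ψ) t

/-- The Klein-Gordon equation `(c⁻² ∂²/∂t² - Δ + c² μ²) q = 0` for an operator-valued field `q`,
given by its smeared values `q f t`; here `(Δ q)(f) = q (Δ f)`, and the second time derivative is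
part of the claim. -/
def KleinGordon {F : Type*} [NormedAddCommGroup F] [NormedSpace ℝ F] {D : Submodule ℂ 𝓗}
    (c μ : ℝ) (q : 𝓢(Space, F) → ℝ → D →ₗ[ℂ] 𝓗) : Prop :=
  ∀ f : 𝓢(Space, F), ∃ v a : ℝ → D →ₗ[ℂ] 𝓗, IsTimeDeriv (q f) v ∧ IsTimeDeriv v a ∧
    ∀ t, ((1 / c ^ 2 : ℝ) : ℂ) • a t - q (Δ f) t + ((c ^ 2 * μ ^ 2 : ℝ) : ℂ) • q f t = 0

/-- `U t = e^{-itH}`: `U` is the strongly continuous one-parameter unitary group whose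
infinitesimal generator is exactly `-iH` (`ψ ∈ dom H` and `Hψ = χ` if and only if `U t ψ` is
differentiable at `t = 0` with derivative `-iχ`). For self-adjoint `H` there is exactly one. -/
structure IsUnitaryGroupOf (H : 𝓗 →ₗ.[ℂ] 𝓗) (U : ℝ → 𝓗 ≃ₗᵢ[ℂ] 𝓗) : Prop where
  map_add : ∀ (s t : ℝ) (ψ : 𝓗), U (s + t) ψ = U s (U t ψ)
  continuous : ∀ ψ : 𝓗, Continuous fun t => U t ψ
  mem_graph_iff : ∀ ψ χ : 𝓗,
    (ψ, χ) ∈ H.graph ↔ HasDerivAt (fun t => U t ψ) (-(Complex.I • χ)) 0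

/-- The Heisenberg evolution `e^{itH} A e^{-itH}` of an operator `A` on a subspace `D` that is
invariant under `U t = e^{-itH}`. -/
def heisenberg {D : Submodule ℂ 𝓗} (U : ℝ → 𝓗 ≃ₗᵢ[ℂ] 𝓗) (hU : ∀ t, ∀ ψ ∈ D, U t ψ ∈ D)
    (A : D →ₗ[ℂ] D) (t : ℝ) : D →ₗ[ℂ] 𝓗 :=
  (U (-t)).toLinearEquiv.toLinearMap ∘ₗ D.subtype ∘ₗ A ∘ₗ
    (U t).toLinearEquiv.toLinearMap.restrict (hU t)

end Operators

section Fields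

variable (𝓗 : Type*) [NormedAddCommGroup 𝓗] [InnerProductSpace ℂ 𝓗] [CompleteSpace 𝓗]

/-- A pair of self-adjoint operator-valued fields `q`, `p` on `ℝ³` in `𝓗` that satisfies the
canonical commutation relations. The fields are tempered operator-valued distributions:
`q f = ∫ f(x) q(x) dx` and `p f = ∫ f(x) p(x) dx`, on a common dense invariant domain `D`. -/
structure CanonicalPair where
  D : Submodule ℂ 𝓗
  dense : Dense (D : Set 𝓗)
  q : Test → 𝓗 →ₗ.[ℂ] 𝓗
  p : Test → 𝓗 →ₗ.[ℂ] 𝓗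
  q_selfAdjoint : ∀ f, IsSelfAdjoint (q f)
  p_selfAdjoint : ∀ f, IsSelfAdjoint (p f)
  q_dom : ∀ f, D ≤ (q f).domain
  p_dom : ∀ f, D ≤ (p f).domain
  q_mem : ∀ f (ψ : D), restrictTo (q f) (q_dom f) ψ ∈ D
  p_mem : ∀ f (ψ : D), restrictTo (p f) (p_dom f) ψ ∈ D
  q_add : ∀ f g, restrictTo (q (f + g)) (q_dom _) =
    restrictTo (q f) (q_dom f) + restrictTo (q g) (q_dom g)
  p_add : ∀ f g, restrictTo (p (f + g)) (p_dom _) =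
    restrictTo (p f) (p_dom f) + restrictTo (p g) (p_dom g)
  q_smul : ∀ (a : ℝ) f, restrictTo (q (a • f)) (q_dom _) = (a : ℂ) • restrictTo (q f) (q_dom f)
  p_smul : ∀ (a : ℝ) f, restrictTo (p (a • f)) (p_dom _) = (a : ℂ) • restrictTo (p f) (p_dom f)
  q_tempered : ∀ φ ψ : D, Continuous fun f => ⟪(φ : 𝓗), restrictTo (q f) (q_dom f) ψ⟫_ℂ
  p_tempered : ∀ φ ψ : D, Continuous fun f => ⟪(φ : 𝓗), restrictTo (p f) (p_dom f) ψ⟫_ℂ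
  /-- `[q(x), p(x')] = i δ(x - x')` -/
  comm_q_p : ∀ (f g : Test) (ψ : D),
    restrictTo (q f) (q_dom f) ⟨restrictTo (p g) (p_dom g) ψ, p_mem g ψ⟩ -
      restrictTo (p g) (p_dom g) ⟨restrictTo (q f) (q_dom f) ψ, q_mem f ψ⟩ =
        (Complex.I * ((∫ x, f x * g x : ℝ) : ℂ)) • (ψ : 𝓗)
  /-- `[q(x), q(x')] = 0` -/
  comm_q_q : ∀ (f g : Test) (ψ : D),
    restrictTo (q f) (q_dom f) ⟨restrictTo (q g) (q_dom g) ψ, q_mem g ψ⟩ =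
      restrictTo (q g) (q_dom g) ⟨restrictTo (q f) (q_dom f) ψ, q_mem f ψ⟩
  /-- `[p(x), p(x')] = 0` -/
  comm_p_p : ∀ (f g : Test) (ψ : D),
    restrictTo (p f) (p_dom f) ⟨restrictTo (p g) (p_dom g) ψ, p_mem g ψ⟩ =
      restrictTo (p g) (p_dom g) ⟨restrictTo (p f) (p_dom f) ψ, p_mem f ψ⟩

variable {𝓗}

/-- The operator `q f` on the invariant domain. -/
def CanonicalPair.qOn (Φ : CanonicalPair 𝓗) (f : Test) : Φ.D →ₗ[ℂ] Φ.D :=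
  (restrictTo (Φ.q f) (Φ.q_dom f)).codRestrict Φ.D (Φ.q_mem f)

/-- The operator `p f` on the invariant domain. -/
def CanonicalPair.pOn (Φ : CanonicalPair 𝓗) (f : Test) : Φ.D →ₗ[ℂ] Φ.D :=
  (restrictTo (Φ.p f) (Φ.p_dom f)).codRestrict Φ.D (Φ.p_mem f)

/-- The `j`-th standard basis vector of `ℝ³`. -/
abbrev unitVec (j : Fin 3) : Space := EuclideanSpace.single j 1

/-- The translate `y ↦ ρ (y - x)`. Smearing a field with it gives the field near `x`,
`q_ρ(x) = ∫ ρ(y - x) q(y) dy`. -/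
def translate (ρ : Test) (x : Space) : Test := SchwartzMap.compSubConstCLM ℝ x ρ

/-- An approximate identity: nonnegative test functions of integral one whose supports shrink to
the origin. -/
structure IsApproxIdentity (ρ : ℕ → Test) : Prop where
  nonneg : ∀ n x, 0 ≤ ρ n x
  integral_eq_one : ∀ n, ∫ x, ρ n x = 1
  support : ∀ ε > 0, ∀ᶠ n in atTop, Function.support (ρ n) ⊆ Metric.ball 0 ε

/-- The energy density `½ (p(x)² + c² |∇q(x)|² + c⁴ μ² q(x)²)` of the fields smeared with `ρ`
around `x`. Here `(∂q/∂xⱼ)_ρ(x) = -q (∂ⱼ ρ(· - x))`, and the sign drops out in the square. -/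
def CanonicalPair.energyDensity (Φ : CanonicalPair 𝓗) (c μ : ℝ) (ρ : Test) (x : Space) :
    Φ.D →ₗ[ℂ] Φ.D :=
  (1 / 2 : ℂ) • (Φ.pOn (translate ρ x) ∘ₗ Φ.pOn (translate ρ x) +
    ((c ^ 2 : ℝ) : ℂ) • ∑ j : Fin 3,
      Φ.qOn (-∂_{unitVec j} (translate ρ x)) ∘ₗ Φ.qOn (-∂_{unitVec j} (translate ρ x)) +
    ((c ^ 4 * μ ^ 2 : ℝ) : ℂ) • Φ.qOn (translate ρ x) ∘ₗ Φ.qOn (translate ρ x))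

/-- The matrix element between `φ` and `ψ` of the smeared energy density at `x` minus the
constant `e`. -/
def CanonicalPair.renormalizedDensity (Φ : CanonicalPair 𝓗) (c μ : ℝ) (ρ : Test) (e : ℝ)
    (φ ψ : Φ.D) (x : Space) : ℂ :=
  ⟪(φ : 𝓗), (Φ.energyDensity c μ ρ x ψ : 𝓗) - (e : ℂ) • (ψ : 𝓗)⟫_ℂ

/-- `H = ½ ∫ (p(x)² + c² |∇q(x)|² + c⁴ μ² q(x)²) dx` on `D`. Products of fields at one point
have the usual renormalized meaning: the fields are smeared with an approximate identity, a
constant (the vacuum energy density of the smeared fields) is subtracted from the energy density,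
the result is integrated over `ℝ³` and the smearing is removed, all in the sense of matrix elements
between vectors of `D`. -/
def CanonicalPair.IsHamiltonian (Φ : CanonicalPair 𝓗) (c μ : ℝ) (H : 𝓗 →ₗ.[ℂ] 𝓗) : Prop :=
  ∃ (hD : Φ.D ≤ H.domain) (ρ : ℕ → Test) (e : ℕ → ℝ), IsApproxIdentity ρ ∧ ∀ φ ψ : Φ.D,
    (∀ n, Integrable fun x => Φ.renormalizedDensity c μ (ρ n) (e n) φ ψ x) ∧
    Tendsto (fun n => ∫ x, Φ.renormalizedDensity c μ (ρ n) (e n) φ ψ x)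
      atTop (𝓝 ⟪(φ : 𝓗), restrictTo H hD ψ⟫_ℂ)

end Fields

section FirstOrder

/-- The symbol `√(4π²|ξ|² + m²)` of `√(-Δ + m²)` under the Fourier transform
`𝓕 f ξ = ∫ exp(-2πi ⟨x, ξ⟩) f(x) dx`. -/
def sqrtSymbol (m : ℝ) (ξ : Space) : ℝ := Real.sqrt (4 * Real.pi ^ 2 * ‖ξ‖ ^ 2 + m ^ 2)

/-- The test functions `f + √(-Δ + m²) g` with `f`, `g` complex Schwartz functions on `ℝ³`, each
represented by its Fourier transform. This is the smallest space that contains the Schwartz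
functions and is mapped to itself by `√(-Δ + m²)`; for `m ≠ 0` it consists of the Schwartz
functions only. -/
def SqrtTest (m : ℝ) : Submodule ℂ (Space → ℂ) where
  carrier := {u | ∃ f g : 𝓢(Space, ℂ), ∀ ξ, u ξ = 𝓕 f ξ + sqrtSymbol m ξ * 𝓕 g ξ}
  add_mem' := by
    rintro u v ⟨f, g, h⟩ ⟨f', g', h'⟩
    refine ⟨f + f', g + g', fun ξ => ?_⟩
    simp only [Pi.add_apply, h, h', FourierTransform.fourier_add, _root_.add_apply]
    ring
  zero_mem' := ⟨0, 0, fun ξ => by simp⟩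
  smul_mem' := by
    rintro a u ⟨f, g, h⟩
    refine ⟨a • f, a • g, fun ξ => ?_⟩
    simp only [Pi.smul_apply, h, FourierTransform.fourier_smul, _root_.smul_apply,
      smul_eq_mul]
    ring

/-- A Schwartz function as an element of `SqrtTest m`. -/
def SqrtTest.ofSchwartz (m : ℝ) (f : 𝓢(Space, ℂ)) : SqrtTest m :=
  ⟨fun ξ => 𝓕 f ξ, f, 0, fun ξ => by simp⟩

/-- The square of the symbol of `√(-Δ + m²)` is the symbol of `-Δ + m²`. -/
theorem sqrtSymbol_sq_mul_fourier (m : ℝ) (f : 𝓢(Space, ℂ)) (ξ : Space) :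
    (sqrtSymbol m ξ : ℂ) * (sqrtSymbol m ξ * 𝓕 f ξ) = 𝓕 (-Δ f + ((m ^ 2 : ℝ) : ℂ) • f) ξ := by
  have hs : (sqrtSymbol m ξ : ℂ) * sqrtSymbol m ξ =
      ((4 * Real.pi ^ 2 * ‖ξ‖ ^ 2 + m ^ 2 : ℝ) : ℂ) := by
    rw [← Complex.ofReal_mul, sqrtSymbol, Real.mul_self_sqrt (by positivity)]
  have hL : 𝓕 (Δ f) ξ = -((4 * Real.pi ^ 2 * ‖ξ‖ ^ 2 : ℝ) : ℂ) * 𝓕 f ξ := by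
    have hg : Function.HasTemperateGrowth ((‖·‖ ^ 2) : Space → ℝ) := by fun_prop
    rw [SchwartzMap.laplacian_eq_fourierMultiplierCLM,
      SchwartzMap.fourierMultiplierCLM_apply, FourierTransform.fourier_smul,
      FourierTransform.fourier_fourierInv_eq, _root_.smul_apply,
      SchwartzMap.smulLeftCLM_apply_apply hg]
    simp only [Complex.real_smul]
    push_cast
    ring
  rw [← mul_assoc, hs, FourierTransform.fourier_add, FourierTransform.fourier_neg,
    FourierTransform.fourier_smul, _root_.add_apply, _root_.neg_apply,
    _root_.smul_apply, hL]
  push_cast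
  simp only [smul_eq_mul]
  ring

/-- The operator `√(-Δ + m²)` on these test functions. -/
def SqrtTest.sqrtOp (m : ℝ) (u : SqrtTest m) : SqrtTest m :=
  ⟨fun ξ => sqrtSymbol m ξ * (u : Space → ℂ) ξ, by
    obtain ⟨f, g, h⟩ := u.2
    refine ⟨-Δ g + ((m ^ 2 : ℝ) : ℂ) • g, f, fun ξ => ?_⟩
    rw [← sqrtSymbol_sq_mul_fourier]
    simp only [h ξ]
    ring⟩

end FirstOrder

end

end ScalarField

open ScalarField

/-!
The Heisenberg equations `∂q/∂t = p` and `∂p/∂t = c² Δq - c⁴ μ² q` come from the commutators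
`[H, q(f)] = -i p(f)` and `[H, p(f)] = -i (c² q(Δf) - c⁴ μ² q(f))`, taken between vectors of `D`.

For the commutators, let `ρ` be an approximate identity. The canonical commutation relations give,
for the energy density smeared with `ρ` at `x`, a commutator with `q(f)` equal to
`-i (∫ f(y) ρ(y - x) dy) p(ρ(· - x))`, and similarly for `p(f)`; the subtracted constants drop out.
It remains to see that `∫ (∫ f(y) ρ(y - x) dy) T(ρ(· - x)) dx → T(f)` for a tempered distribution
`T`, the matrix elements of `p` or `q` (`tendsto_integral_smeared`). The integral is `T` applied to
the convolution of `f` with the reflection of `ρ` and with `ρ`, hence an average of the numbers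
`T(f(· - a))` over small `a`, and translation is continuous on the Schwartz space. This uses the
identity `T(h * g) = ∫ h(x) T(g(· - x)) dx` (`clm_schwartzConv`). The Schwartz space is not normed,
so the integral of Schwartz functions is taken pointwise, and shown to commute with `T` by factoring
`T` through a Banach space of bounded weighted derivatives (`clm_schwartzIntegral`).

From the commutators, `⟪φ, q(f, t) ψ⟫` is differentiable in `t` with derivative `⟪φ, p(f, t) ψ⟫` for
`φ`, `ψ` in `D`. As `p(f, t) ψ` is norm continuous and `D` is dense, `q(f, t) ψ` is the integral of
its would-be derivative, and so differentiable in norm (`hasDerivAt_of_inner`).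

The first-order equation gives the Klein-Gordon equation when it is applied twice, because the
square of `√(-Δ + c² μ²)` is `-Δ + c² μ²`.
-/

namespace ScalarField

/-! ### Weak integrals of Schwartz functions -/

section WeakIntegral

variable {E F : Type*} [NormedAddCommGroup E] [NormedSpace ℝ E]
  [NormedAddCommGroup F] [NormedSpace ℝ F]

/-- The Banach space of bounded continuous functions with values in the `n`-linear maps. It is a
type synonym, so that its topology is found through its norm. -/
noncomputable def WeightedDerivSpace (E F : Type*) [NormedAddCommGroup E] [NormedSpace ℝ E]
    [NormedAddCommGroup F] [NormedSpace ℝ F] (n : ℕ) : Type _ :=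
  BoundedContinuousFunction E (E [×n]→L[ℝ] F)

namespace WeightedDerivSpace

noncomputable instance (n : ℕ) : NormedAddCommGroup (WeightedDerivSpace E F n) :=
  inferInstanceAs (NormedAddCommGroup (BoundedContinuousFunction E (E [×n]→L[ℝ] F)))

noncomputable instance (n : ℕ) : NormedSpace ℝ (WeightedDerivSpace E F n) :=
  inferInstanceAs (NormedSpace ℝ (BoundedContinuousFunction E (E [×n]→L[ℝ] F)))

instance [CompleteSpace F] (n : ℕ) : CompleteSpace (WeightedDerivSpace E F n) :=
  inferInstanceAs (CompleteSpace (BoundedContinuousFunction E (E [×n]→L[ℝ] F)))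

/-- Evaluation at a point. -/
noncomputable def eval {n : ℕ} (y : E) : WeightedDerivSpace E F n →L[ℝ] E [×n]→L[ℝ] F :=
  BoundedContinuousFunction.evalCLM ℝ y

theorem ext {n : ℕ} {u v : WeightedDerivSpace E F n} (h : ∀ y, eval y u = eval y v) : u = v :=
  BoundedContinuousFunction.ext h

theorem norm_eval_le {n : ℕ} (u : WeightedDerivSpace E F n) (y : E) : ‖eval y u‖ ≤ ‖u‖ :=
  BoundedContinuousFunction.norm_coe_le_norm u y

/-- A continuous function with a global bound, as an element of the space. -/
noncomputable def mk {n : ℕ} (u : E → E [×n]→L[ℝ] F) (hu : Continuous u) (C : ℝ)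
    (h : ∀ y, ‖u y‖ ≤ C) : WeightedDerivSpace E F n :=
  BoundedContinuousFunction.ofNormedAddCommGroup u hu C h

@[simp]
theorem eval_mk {n : ℕ} (u : E → E [×n]→L[ℝ] F) (hu : Continuous u) (C : ℝ)
    (h : ∀ y, ‖u y‖ ≤ C) (y : E) : eval y (mk u hu C h) = u y := rfl

theorem norm_mk_le {n : ℕ} (u : E → E [×n]→L[ℝ] F) (hu : Continuous u) {C : ℝ}
    (h : ∀ y, ‖u y‖ ≤ C) (hC : 0 ≤ C) : ‖mk u hu C h‖ ≤ C :=
  BoundedContinuousFunction.norm_ofNormedAddCommGroup_le hu hC h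

end WeightedDerivSpace

open WeightedDerivSpace

theorem continuous_norm_pow_smul_iteratedFDeriv (k n : ℕ) (f : 𝓢(E, F)) :
    Continuous fun y => ‖y‖ ^ k • iteratedFDeriv ℝ n f y :=
  (continuous_norm.pow k).smul ((f.smooth ⊤).continuous_iteratedFDeriv (mod_cast le_top))

theorem norm_norm_pow_smul_iteratedFDeriv_le (k n : ℕ) (f : 𝓢(E, F)) (y : E) :
    ‖‖y‖ ^ k • iteratedFDeriv ℝ n f y‖ ≤ SchwartzMap.seminorm ℝ k n f := by
  rw [norm_smul, norm_pow, norm_norm]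
  exact SchwartzMap.le_seminorm ℝ k n f y

/-- The map `f ↦ ‖·‖ ^ k • Dⁿ f` from the Schwartz space to the Banach space of bounded continuous
functions. It turns the Schwartz seminorm with indices `k` and `n` into a norm. -/
noncomputable def weightedDeriv (k n : ℕ) : 𝓢(E, F) →L[ℝ] WeightedDerivSpace E F n :=
  SchwartzMap.mkCLMtoNormedSpace (𝕜 := ℝ)
    (fun f => mk _ (continuous_norm_pow_smul_iteratedFDeriv k n f) _
      (norm_norm_pow_smul_iteratedFDeriv_le k n f))
    (fun f g => WeightedDerivSpace.ext fun y => by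
      simp only [map_add, eval_mk, ← smul_add]
      congr 1
      exact iteratedFDeriv_add_apply (f.contDiffAt n) (g.contDiffAt n))
    (fun a f => WeightedDerivSpace.ext fun y => by
      simp only [map_smul, eval_mk, RingHom.id_apply]
      rw [smul_comm a]
      congr 1
      exact iteratedFDeriv_const_smul_apply (f.contDiffAt n))
    ⟨{(k, n)}, 1, zero_le_one, fun f => by
      rw [Finset.sup_singleton, one_mul]
      exact norm_mk_le _ _ _ (apply_nonneg _ _)⟩

@[simp]
theorem eval_weightedDeriv (k n : ℕ) (f : 𝓢(E, F)) (y : E) :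
    eval y (weightedDeriv k n f) = ‖y‖ ^ k • iteratedFDeriv ℝ n f y := rfl

theorem norm_weightedDeriv_le (k n : ℕ) (f : 𝓢(E, F)) :
    ‖weightedDeriv k n f‖ ≤ SchwartzMap.seminorm ℝ k n f :=
  norm_mk_le _ (continuous_norm_pow_smul_iteratedFDeriv k n f)
    (norm_norm_pow_smul_iteratedFDeriv_le k n f) (apply_nonneg _ _)

theorem seminorm_le_norm_weightedDeriv (k n : ℕ) (f : 𝓢(E, F)) :
    SchwartzMap.seminorm ℝ k n f ≤ ‖weightedDeriv k n f‖ :=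
  SchwartzMap.seminorm_le_bound ℝ k n f (norm_nonneg _) fun y => by
    simpa [norm_smul] using norm_eval_le (weightedDeriv k n f) y

/-- A continuous functional on the Schwartz space with values in a finite-dimensional space factors
through finitely many of the Banach spaces of weighted derivatives, by the Hahn-Banach theorem. -/
theorem exists_factor_weightedDeriv {G : Type*} [NormedAddCommGroup G] [NormedSpace ℝ G]
    [FiniteDimensional ℝ G] (T : 𝓢(E, F) →L[ℝ] G) :
    ∃ (s : Finset (ℕ × ℕ))
      (S : (∀ i : s, WeightedDerivSpace E F i.1.2) →L[ℝ] G),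
      ∀ f, T f = S fun i => weightedDeriv i.1.1 i.1.2 f := by
  obtain ⟨s, C, -, hC⟩ := Seminorm.bound_of_continuous (schwartz_withSeminorms ℝ E F)
    ((normSeminorm ℝ G).comp T.toLinearMap) (continuous_norm.comp T.continuous)
  let ι : 𝓢(E, F) →ₗ[ℝ] (∀ i : s, WeightedDerivSpace E F i.1.2) :=
    LinearMap.pi fun i => (weightedDeriv i.1.1 i.1.2).toLinearMap
  have hb : ∀ f, ‖T f‖ ≤ C * ‖ι f‖ := fun f => by
    refine (hC f).trans ?_
    rw [smul_apply, NNReal.smul_def, smul_eq_mul]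
    refine mul_le_mul_of_nonneg_left ?_ C.2
    refine Seminorm.finset_sup_apply_le (norm_nonneg _) fun i hi => ?_
    exact (seminorm_le_norm_weightedDeriv i.1 i.2 f).trans (norm_le_pi_norm (ι f) ⟨i, hi⟩)
  -- `T` descends to the range of `ι`, on which it is bounded.
  have hker : LinearMap.ker ι.rangeRestrict ≤ LinearMap.ker T.toLinearMap := fun f hf => by
    have h0 : ι f = 0 := congrArg Subtype.val (LinearMap.mem_ker.1 hf)
    have := hb f
    rw [h0, norm_zero, mul_zero] at this
    exact LinearMap.mem_ker.2 (norm_le_zero_iff.1 this)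
  obtain ⟨S₀, hS₀⟩ : ∃ S₀ : LinearMap.range ι →ₗ[ℝ] G, T.toLinearMap = S₀ ∘ₗ ι.rangeRestrict := by
    obtain ⟨r, hr⟩ := ι.rangeRestrict.exists_rightInverse_of_surjective
      (LinearMap.range_eq_top.2 ι.surjective_rangeRestrict)
    refine ⟨T.toLinearMap ∘ₗ r, LinearMap.ext fun f => ?_⟩
    have : f - r (ι.rangeRestrict f) ∈ LinearMap.ker ι.rangeRestrict := by
      rw [LinearMap.mem_ker, map_sub, sub_eq_zero]
      exact (LinearMap.congr_fun hr (ι.rangeRestrict f)).symm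
    have := LinearMap.mem_ker.1 (hker this)
    rwa [map_sub, sub_eq_zero] at this
  have hS₁ : ∀ u, ‖S₀ u‖ ≤ C * ‖u‖ := fun u => by
    obtain ⟨f, rfl⟩ := ι.surjective_rangeRestrict u
    have := LinearMap.congr_fun hS₀ f
    rw [LinearMap.comp_apply] at this
    rw [← this]
    exact hb f
  obtain ⟨S, hS⟩ := (S₀.mkContinuous C hS₁).exist_extension_of_finiteDimensional_range
  refine ⟨s, S, fun f => ?_⟩
  have h1 := LinearMap.congr_fun hS₀ f
  have h2 := DFunLike.congr_fun hS (ι.rangeRestrict f)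
  exact h1.trans h2

variable {X : Type*} [TopologicalSpace X] [SecondCountableTopology X] [MeasurableSpace X]
  [OpensMeasurableSpace X] {m : Measure X} {Φ : X → 𝓢(E, F)}

theorem integrable_weightedDeriv (hΦ : Continuous Φ)
    (hint : ∀ k n, Integrable (fun x => SchwartzMap.seminorm ℝ k n (Φ x)) m) (k n : ℕ) :
    Integrable (fun x => weightedDeriv k n (Φ x)) m :=
  (hint k n).mono' ((weightedDeriv k n).continuous.comp hΦ).aestronglyMeasurable
    (.of_forall fun x => norm_weightedDeriv_le k n (Φ x))

theorem integrable_iteratedFDeriv (hΦ : Continuous Φ)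
    (hint : ∀ k n, Integrable (fun x => SchwartzMap.seminorm ℝ k n (Φ x)) m) (n : ℕ) (y : E) :
    Integrable (fun x => iteratedFDeriv ℝ n (Φ x) y) m := by
  simpa using (WeightedDerivSpace.eval y).integrable_comp
    (integrable_weightedDeriv hΦ hint 0 n)

theorem hasFDerivAt_integral_iteratedFDeriv (hΦ : Continuous Φ)
    (hint : ∀ k n, Integrable (fun x => SchwartzMap.seminorm ℝ k n (Φ x)) m) (n : ℕ) (y : E) :
    HasFDerivAt (fun y => ∫ x, iteratedFDeriv ℝ n (Φ x) y ∂m)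
      (∫ x, fderiv ℝ (iteratedFDeriv ℝ n (Φ x)) y ∂m) y := by
  refine hasFDerivAt_integral_of_dominated_of_fderiv_le (𝕜 := ℝ) (s := Set.univ)
    (F' := fun z x => fderiv ℝ (iteratedFDeriv ℝ n (Φ x)) z)
    (bound := fun x => SchwartzMap.seminorm ℝ 0 (n + 1) (Φ x)) univ_mem
    (.of_forall fun z => (integrable_iteratedFDeriv hΦ hint n z).1)
    (integrable_iteratedFDeriv hΦ hint n y) ?_ (.of_forall fun x z _ => (?_ : _ ≤ _))
    (hint 0 (n + 1)) (.of_forall fun x z _ => ?_)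
  · have h := (continuousMultilinearCurryLeftEquiv ℝ
      (fun _ : Fin (n + 1) => E) F).continuous.comp_aestronglyMeasurable
        (integrable_iteratedFDeriv hΦ hint (n + 1) y).1
    simp only [iteratedFDeriv_succ_eq_comp_left, Function.comp_apply,
      LinearIsometryEquiv.apply_symm_apply] at h
    exact h
  · rw [norm_fderiv_iteratedFDeriv]
    simpa using SchwartzMap.le_seminorm ℝ 0 (n + 1) (Φ x) z
  · exact (((Φ x).smooth ⊤).differentiable_iteratedFDeriv
      (by exact_mod_cast ENat.natCast_lt_top n) z).hasFDerivAt

/-- Differentiation under the integral sign, to all orders. -/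
theorem iteratedFDeriv_integral (hΦ : Continuous Φ)
    (hint : ∀ k n, Integrable (fun x => SchwartzMap.seminorm ℝ k n (Φ x)) m) (n : ℕ) :
    iteratedFDeriv ℝ n (fun y => ∫ x, Φ x y ∂m) =
      fun y => ∫ x, iteratedFDeriv ℝ n (Φ x) y ∂m := by
  induction n with
  | zero =>
    ext1 y
    simp only [iteratedFDeriv_zero_eq_comp, Function.comp_apply]
    exact ((continuousMultilinearCurryFin0 ℝ E F).symm.toContinuousLinearEquiv.integral_comp_comm
      _).symm
  | succ n ih =>
    ext1 y
    rw [iteratedFDeriv_succ_eq_comp_left, ih, Function.comp_apply,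
      (hasFDerivAt_integral_iteratedFDeriv hΦ hint n y).fderiv]
    simp only [iteratedFDeriv_succ_eq_comp_left, Function.comp_apply]
    exact (ContinuousLinearEquiv.integral_comp_comm (𝕜 := ℝ) (E := E →L[ℝ] (E [×n]→L[ℝ] F))
      (F := E [×(n + 1)]→L[ℝ] F) (μ := m) (continuousMultilinearCurryLeftEquiv ℝ
        (fun _ : Fin (n + 1) => E) F).symm.toContinuousLinearEquiv _).symm

/-- The weak integral of a continuous family `Φ` of Schwartz functions all of whose seminorms are
integrable. -/
noncomputable def schwartzIntegral (hΦ : Continuous Φ)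
    (hint : ∀ k n, Integrable (fun x => SchwartzMap.seminorm ℝ k n (Φ x)) m) : 𝓢(E, F) where
  toFun y := ∫ x, Φ x y ∂m
  smooth' := by
    refine contDiff_of_differentiable_iteratedFDeriv fun n _ y => ?_
    rw [iteratedFDeriv_integral hΦ hint]
    exact (hasFDerivAt_integral_iteratedFDeriv hΦ hint n y).differentiableAt
  decay' k n := by
    refine ⟨∫ x, SchwartzMap.seminorm ℝ k n (Φ x) ∂m, fun y => ?_⟩
    rw [iteratedFDeriv_integral hΦ hint, ← norm_norm y, ← norm_pow, ← norm_smul,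
      ← integral_smul]
    refine norm_integral_le_of_norm_le (hint k n) (.of_forall fun x => ?_)
    rw [norm_smul, norm_pow, norm_norm]
    exact SchwartzMap.le_seminorm ℝ k n (Φ x) y

variable {G : Type*} [NormedAddCommGroup G] [NormedSpace ℝ G] [FiniteDimensional ℝ G]

theorem integrable_clm_comp (hΦ : Continuous Φ)
    (hint : ∀ k n, Integrable (fun x => SchwartzMap.seminorm ℝ k n (Φ x)) m)
    (T : 𝓢(E, F) →L[ℝ] G) : Integrable (fun x => T (Φ x)) m := by
  obtain ⟨s, S, hS⟩ := exists_factor_weightedDeriv T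
  simp only [hS]
  exact S.integrable_comp (Integrable.of_eval fun i => integrable_weightedDeriv hΦ hint _ _)

/-- Tempered functionals commute with the weak integral: factored through a Banach space, the
functional commutes with the Bochner integral there, which is identified by evaluation at points. -/
theorem clm_schwartzIntegral [CompleteSpace F] (hΦ : Continuous Φ)
    (hint : ∀ k n, Integrable (fun x => SchwartzMap.seminorm ℝ k n (Φ x)) m)
    (T : 𝓢(E, F) →L[ℝ] G) : T (schwartzIntegral hΦ hint) = ∫ x, T (Φ x) ∂m := by
  obtain ⟨s, S, hS⟩ := exists_factor_weightedDeriv T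
  have hi : ∀ i : s, Integrable (fun x => weightedDeriv i.1.1 i.1.2 (Φ x)) m :=
    fun i => integrable_weightedDeriv hΦ hint _ _
  simp only [hS]
  rw [S.integral_comp_comm (Integrable.of_eval hi)]
  congr 1
  ext i : 1
  rw [eval_integral hi]
  refine WeightedDerivSpace.ext fun y => ?_
  have := (WeightedDerivSpace.eval y).integral_comp_comm (hi i)
  simp only [eval_weightedDeriv] at this
  rw [← this, eval_weightedDeriv, integral_smul]
  congr 1
  exact congrFun (iteratedFDeriv_integral hΦ hint i.1.2) y

end WeakIntegral

/-! ### Translation and convolution of Schwartz functions -/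

section Translation

variable {E F : Type*} [NormedAddCommGroup E] [NormedSpace ℝ E]
  [NormedAddCommGroup F] [NormedSpace ℝ F]

theorem iteratedFDeriv_compSubConstCLM (f : 𝓢(E, F)) (a : E) (n : ℕ) (y : E) :
    iteratedFDeriv ℝ n (SchwartzMap.compSubConstCLM ℝ a f) y = iteratedFDeriv ℝ n f (y - a) :=
  iteratedFDeriv_comp_sub n a y

/-- The Schwartz seminorms of a translate grow at most polynomially. -/
theorem exists_seminorm_compSubConstCLM_le (f : 𝓢(E, F)) (k n : ℕ) :
    ∃ C, 0 ≤ C ∧ ∀ a, SchwartzMap.seminorm ℝ k n (SchwartzMap.compSubConstCLM ℝ a f) ≤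
      C * (1 + ‖a‖) ^ k := by
  refine ⟨2 ^ k * (SchwartzMap.seminorm ℝ 0 n f + SchwartzMap.seminorm ℝ k n f), by positivity,
    fun a => SchwartzMap.seminorm_le_bound ℝ k n _ (by positivity) fun y => ?_⟩
  rw [iteratedFDeriv_compSubConstCLM]
  have h0 := SchwartzMap.le_seminorm ℝ 0 n f (y - a)
  have hk := SchwartzMap.le_seminorm ℝ k n f (y - a)
  rw [pow_zero, one_mul] at h0
  have hy : ‖y‖ ^ k ≤ 2 ^ k * (1 + ‖y - a‖ ^ k) * (1 + ‖a‖) ^ k := by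
    have h1 : ‖y‖ ≤ (1 + ‖y - a‖) * (1 + ‖a‖) := by
      have := norm_add_le (y - a) a
      rw [sub_add_cancel] at this
      nlinarith [norm_nonneg (y - a), norm_nonneg a]
    have h2 : (1 + ‖y - a‖) ^ k ≤ 2 ^ k * (1 + ‖y - a‖ ^ k) := by
      refine (add_pow_le zero_le_one (norm_nonneg (y - a)) k).trans ?_
      rw [one_pow]
      gcongr
      · norm_num
      · omega
    calc ‖y‖ ^ k ≤ ((1 + ‖y - a‖) * (1 + ‖a‖)) ^ k := by gcongr
      _ = (1 + ‖y - a‖) ^ k * (1 + ‖a‖) ^ k := mul_pow _ _ _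
      _ ≤ _ := by gcongr
  calc ‖y‖ ^ k * ‖iteratedFDeriv ℝ n f (y - a)‖
      ≤ 2 ^ k * (1 + ‖y - a‖ ^ k) * (1 + ‖a‖) ^ k * ‖iteratedFDeriv ℝ n f (y - a)‖ := by gcongr
    _ = 2 ^ k * (‖iteratedFDeriv ℝ n f (y - a)‖ + ‖y - a‖ ^ k * ‖iteratedFDeriv ℝ n f (y - a)‖) *
        (1 + ‖a‖) ^ k := by ring
    _ ≤ _ := by gcongr

/-- Translation is continuous on the Schwartz space: by the mean value inequality, translates
differ in each seminorm by at most their distance times a seminorm with one more derivative. -/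
theorem continuous_compSubConstCLM (f : 𝓢(E, F)) :
    Continuous fun a => SchwartzMap.compSubConstCLM ℝ a f := by
  rw [continuous_iff_continuousAt]
  intro a
  refine ((schwartz_withSeminorms ℝ E F).tendsto_nhds _ _).2 fun ⟨k, n⟩ => ?_
  obtain ⟨C, hC, h⟩ := exists_seminorm_compSubConstCLM_le f k (n + 1)
  have key : ∀ b ∈ Metric.ball a 1, SchwartzMap.seminorm ℝ k n (SchwartzMap.compSubConstCLM ℝ b f -
      SchwartzMap.compSubConstCLM ℝ a f) ≤ C * (2 + ‖a‖) ^ k * ‖b - a‖ := fun b hb => by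
    refine SchwartzMap.seminorm_le_bound ℝ k n _ (by positivity) fun y => ?_
    have hsub : iteratedFDeriv ℝ n (SchwartzMap.compSubConstCLM ℝ b f -
        SchwartzMap.compSubConstCLM ℝ a f : 𝓢(E, F)) y =
          iteratedFDeriv ℝ n f (y - b) - iteratedFDeriv ℝ n f (y - a) := by
      rw [← iteratedFDeriv_compSubConstCLM, ← iteratedFDeriv_compSubConstCLM]
      exact iteratedFDeriv_sub_apply (SchwartzMap.contDiffAt _ n) (SchwartzMap.contDiffAt _ n)
    rw [hsub, ← norm_norm y, ← norm_pow, ← norm_smul, smul_sub]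
    refine (convex_ball a 1).norm_image_sub_le_of_norm_hasFDerivWithin_le
      (f := fun z => ‖y‖ ^ k • iteratedFDeriv ℝ n f (y - z))
      (f' := fun z => ‖y‖ ^ k • -fderiv ℝ (iteratedFDeriv ℝ n f) (y - z))
      (fun z hz => ?_) (fun z hz => ?_) (Metric.mem_ball_self one_pos) hb
    · have hd : HasFDerivAt (iteratedFDeriv ℝ n f) (fderiv ℝ (iteratedFDeriv ℝ n f) (y - z))
          (y - z) := ((f.smooth ⊤).differentiable_iteratedFDeriv
        (by exact_mod_cast ENat.natCast_lt_top n) _).hasFDerivAt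
      have := (hd.comp z ((hasFDerivAt_id z).const_sub y)).const_smul (‖y‖ ^ k)
      rw [ContinuousLinearMap.comp_neg, ContinuousLinearMap.comp_id] at this
      exact this.hasFDerivWithinAt
    · rw [norm_smul, norm_neg, norm_fderiv_iteratedFDeriv, norm_pow, norm_norm,
        ← iteratedFDeriv_compSubConstCLM]
      refine (SchwartzMap.le_seminorm ℝ k (n + 1) _ y).trans ((h z).trans ?_)
      have : ‖z‖ ≤ 1 + ‖a‖ := by
        have h1 := norm_add_le (z - a) a
        rw [sub_add_cancel] at h1
        have h2 := mem_ball_iff_norm.1 hz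
        linarith
      gcongr ?_ * ?_ ^ k
      linarith
  intro ε hε
  have ht : Tendsto (fun b => C * (2 + ‖a‖) ^ k * ‖b - a‖) (𝓝 a) (𝓝 0) := by
    have : Continuous fun b => C * (2 + ‖a‖) ^ k * ‖b - a‖ := by fun_prop
    simpa using this.tendsto a
  filter_upwards [ht.eventually_lt_const hε, Metric.ball_mem_nhds a one_pos] with b hb hb1
  exact (key b hb1).trans_lt hb

theorem continuous_smul_compSubConstCLM (h : 𝓢(E, ℝ)) (g : 𝓢(E, F)) :
    Continuous fun x => h x • SchwartzMap.compSubConstCLM ℝ x g :=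
  h.continuous.smul (continuous_compSubConstCLM g)

variable [MeasurableSpace E] [BorelSpace E] [FiniteDimensional ℝ E]
  {m : Measure E} [m.HasTemperateGrowth]

theorem integrable_seminorm_smul_compSubConstCLM (h : 𝓢(E, ℝ)) (g : 𝓢(E, F)) (k n : ℕ) :
    Integrable (fun x => SchwartzMap.seminorm ℝ k n (h x • SchwartzMap.compSubConstCLM ℝ x g))
      m := by
  obtain ⟨C, hC, hb⟩ := exists_seminorm_compSubConstCLM_le g k n
  have hi : Integrable (fun x => C * 2 ^ k * (‖x‖ ^ 0 * ‖h x‖ + ‖x‖ ^ k * ‖h x‖)) m :=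
    ((h.integrable_pow_mul m 0).add (h.integrable_pow_mul m k)).const_mul _
  refine hi.mono' ?_ (.of_forall fun x => ?_)
  · exact (((schwartz_withSeminorms ℝ E F).continuous_seminorm (k, n)).comp
      (continuous_smul_compSubConstCLM h g)).aestronglyMeasurable
  · have h2 : (1 + ‖x‖) ^ k ≤ 2 ^ k * (1 + ‖x‖ ^ k) := by
      refine (add_pow_le zero_le_one (norm_nonneg x) k).trans ?_
      rw [one_pow]
      gcongr
      · norm_num
      · omega
    rw [Real.norm_of_nonneg (apply_nonneg _ _), map_smul_eq_mul]
    calc ‖h x‖ * SchwartzMap.seminorm ℝ k n (SchwartzMap.compSubConstCLM ℝ x g)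
        ≤ ‖h x‖ * (C * (2 ^ k * (1 + ‖x‖ ^ k))) := by gcongr; exact (hb x).trans (by gcongr)
      _ = _ := by ring

variable (m) in
/-- The convolution of two Schwartz functions, `∫ h(x) g(· - x) dx`. -/
noncomputable def schwartzConv (h : 𝓢(E, ℝ)) (g : 𝓢(E, F)) : 𝓢(E, F) :=
  schwartzIntegral (m := m) (continuous_smul_compSubConstCLM h g)
    (integrable_seminorm_smul_compSubConstCLM h g)

theorem schwartzConv_apply (h : 𝓢(E, ℝ)) (g : 𝓢(E, F)) (y : E) :
    schwartzConv m h g y = ∫ x, h x • g (y - x) ∂m := rfl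

variable {G : Type*} [NormedAddCommGroup G] [NormedSpace ℝ G] [FiniteDimensional ℝ G]

variable (m) in
theorem integrable_smul_clm_compSubConstCLM (T : 𝓢(E, F) →L[ℝ] G) (h : 𝓢(E, ℝ)) (g : 𝓢(E, F)) :
    Integrable (fun x => h x • T (SchwartzMap.compSubConstCLM ℝ x g)) m := by
  simpa only [map_smul] using integrable_clm_comp (m := m) (continuous_smul_compSubConstCLM h g)
    (integrable_seminorm_smul_compSubConstCLM h g) T

/-- A tempered functional `T` on a convolution: `T(h * g) = ∫ h(x) T(g(· - x)) dx`. -/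
theorem clm_schwartzConv [CompleteSpace F] (T : 𝓢(E, F) →L[ℝ] G) (h : 𝓢(E, ℝ)) (g : 𝓢(E, F)) :
    T (schwartzConv m h g) = ∫ x, h x • T (SchwartzMap.compSubConstCLM ℝ x g) ∂m := by
  simp only [← map_smul]
  exact clm_schwartzIntegral _ _ T

theorem schwartzConv_comm [m.IsAddHaarMeasure] (h g : 𝓢(E, ℝ)) :
    schwartzConv m h g = schwartzConv m g h := by
  ext y
  rw [schwartzConv_apply, schwartzConv_apply,
    ← integral_sub_left_eq_self (fun x => h x • g (y - x)) m y]
  refine integral_congr_ae (.of_forall fun x => ?_)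
  simp [mul_comm]

/-- An average of values that are all within `ε` of `z` is within `ε` of `z`. -/
theorem norm_integral_smul_sub_le {X : Type*} [MeasurableSpace X] {m : Measure X} {w : X → ℝ}
    {u : X → G} {z : G} {ε : ℝ} (hw : ∀ x, 0 ≤ w x) (hw1 : ∫ x, w x ∂m = 1)
    (hu : Integrable (fun x => w x • u x) m) (h : ∀ x, w x ≠ 0 → ‖u x - z‖ ≤ ε) :
    ‖∫ x, w x • u x ∂m - z‖ ≤ ε := by
  have hwi : Integrable w m := by
    by_contra hn
    rw [integral_undef hn] at hw1
    exact zero_ne_one hw1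
  have : CompleteSpace G := FiniteDimensional.complete ℝ G
  have hz : z = ∫ x, w x • z ∂m := by rw [integral_smul_const, hw1, one_smul]
  have he : ε = ∫ x, w x * ε ∂m := by rw [integral_mul_const, hw1, one_mul]
  calc ‖∫ x, w x • u x ∂m - z‖ = ‖∫ x, (w x • u x - w x • z) ∂m‖ := by
        rw [integral_sub hu (hwi.smul_const z), ← hz]
    _ ≤ ∫ x, w x * ε ∂m := by
        refine norm_integral_le_of_norm_le (hwi.mul_const ε) (.of_forall fun x => ?_)
        rw [← smul_sub, norm_smul, Real.norm_of_nonneg (hw x)]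
        by_cases hx : w x = 0
        · simp [hx]
        · exact mul_le_mul_of_nonneg_left (h x hx) (hw x)
    _ = ε := he.symm

end Translation

/-! ### Smearing with an approximate identity -/

/-- The reflection `f(-·)` of a test function. -/
noncomputable def reflect : Test →L[ℝ] Test :=
  SchwartzMap.compCLMOfContinuousLinearEquiv ℝ (ContinuousLinearEquiv.neg ℝ)

theorem reflect_apply (f : Test) (x : Space) : reflect f x = f (-x) := rfl

/-- The weight `∫ f(y) ρ(y - x) dy` is a Schwartz function of `x`. -/
theorem integral_mul_translate (f ρ : Test) (x : Space) :
    ∫ y, f y * translate ρ x y = schwartzConv volume (reflect ρ) f x := by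
  rw [schwartzConv_apply, ← integral_sub_left_eq_self _ volume x]
  refine integral_congr_ae (.of_forall fun y => ?_)
  simp [reflect_apply, translate, mul_comm]

theorem integrable_smeared (ρ : Test) (T : Test →L[ℝ] ℂ) (f : Test) :
    Integrable fun x => (∫ y, f y * translate ρ x y) • T (translate ρ x) := by
  simp only [integral_mul_translate]
  exact integrable_smul_clm_compSubConstCLM volume T (schwartzConv volume (reflect ρ) f) ρ

/-- A tempered distribution smeared with an approximate identity converges to the distribution:
the left-hand side is `T` applied to the mollification of `f` by `ρ n` and its reflection, and so
an average of the values of `T` at small translates of `f`. -/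
theorem tendsto_integral_smeared {ρ : ℕ → Test} (hρ : IsApproxIdentity ρ) (T : Test →L[ℝ] ℂ)
    (f : Test) :
    Tendsto (fun n => ∫ x, (∫ y, f y * translate (ρ n) x y) • T (translate (ρ n) x))
      atTop (𝓝 (T f)) := by
  simp only [integral_mul_translate]
  have hinner : ∀ n r, T (translate (schwartzConv volume (reflect (ρ n)) f) r) =
      ∫ s, reflect (ρ n) s • T (translate (translate f s) r) := fun n r =>
    clm_schwartzConv (m := volume) (T ∘L SchwartzMap.compSubConstCLM ℝ r) (reflect (ρ n)) f
  have hT : ∀ n, ∫ x, schwartzConv volume (reflect (ρ n)) f x • T (translate (ρ n) x) =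
      ∫ r, ρ n r • ∫ s, reflect (ρ n) s • T (translate (translate f s) r) := by
    intro n
    have h1 := clm_schwartzConv (m := volume) T (schwartzConv volume (reflect (ρ n)) f) (ρ n)
    rw [schwartzConv_comm, clm_schwartzConv] at h1
    simp only [← hinner]
    exact h1.symm
  -- The double average is over values `T (translate f (s + r))` with `s` and `r` near the origin.
  simp only [hT]
  rw [Metric.tendsto_nhds]
  intro ε hε
  have hcont : Continuous fun a => T (translate f a) :=
    T.continuous.comp (continuous_compSubConstCLM f)
  have h0 : T (translate f 0) = T f := by simp [translate]
  obtain ⟨δ, hδ, hball⟩ := Metric.continuousAt_iff.1 hcont.continuousAt (ε / 2) (half_pos hε)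
  filter_upwards [hρ.support (δ / 2) (half_pos hδ)] with n hn
  have hRi : ∫ s, reflect (ρ n) s = 1 := by
    simp only [reflect_apply]
    rw [integral_neg_eq_self (fun x => ρ n x) volume, hρ.integral_eq_one]
  rw [dist_eq_norm]
  refine lt_of_le_of_lt ?_ (half_lt_self hε)
  refine norm_integral_smul_sub_le (hρ.nonneg n) (hρ.integral_eq_one n) ?_ fun r hr => ?_
  · simp only [← hinner]
    exact integrable_smul_clm_compSubConstCLM volume T (ρ n)
      (schwartzConv volume (reflect (ρ n)) f)
  · refine norm_integral_smul_sub_le (fun s => hρ.nonneg n _) hRi ?_ fun s hs => ?_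
    · exact integrable_smul_clm_compSubConstCLM volume (T ∘L SchwartzMap.compSubConstCLM ℝ r) _ f
    · have hr' : ‖r‖ < δ / 2 := by simpa using hn hr
      have hs' : ‖s‖ < δ / 2 := by simpa using hn hs
      have := hball (x := s + r) (by
        rw [dist_zero_right]
        linarith [norm_add_le s r])
      rw [h0, dist_eq_norm] at this
      rw [translate, translate, SchwartzMap.compSubConstCLM_comp]
      exact this.le

/-! ### Heisenberg's equation of motion -/

section Evolution

variable {𝓗 : Type*} [NormedAddCommGroup 𝓗] [InnerProductSpace ℂ 𝓗]

/-- A product rule at a zero of the first factor: the second factor need only be continuous. -/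
theorem hasDerivAt_inner_sub {x w : ℝ → 𝓗} {x' : 𝓗} {t : ℝ} (hx : HasDerivAt x x' t)
    (hw : ContinuousAt w t) : HasDerivAt (fun s => ⟪x s - x t, w s⟫_ℂ) ⟪x', w t⟫_ℂ t := by
  rw [hasDerivAt_iff_tendsto_slope] at hx ⊢
  refine (hx.inner (𝕜 := ℂ) (hw.tendsto.mono_left nhdsWithin_le_nhds)).congr fun s => ?_
  simp [slope_def_module, inner_smul_left_eq_smul, inner_sub_left]

theorem inner_restrictTo_of_isSelfAdjoint [CompleteSpace 𝓗] {A : 𝓗 →ₗ.[ℂ] 𝓗}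
    (hA : IsSelfAdjoint A) {D : Submodule ℂ 𝓗} (hD : D ≤ A.domain) (φ ψ : D) :
    ⟪restrictTo A hD φ, (ψ : 𝓗)⟫_ℂ = ⟪(φ : 𝓗), restrictTo A hD ψ⟫_ℂ := by
  have h := A.adjoint_isFormalAdjoint hA.dense_domain
  rw [LinearPMap.isSelfAdjoint_def.1 hA] at h
  exact h (Submodule.inclusion hD φ) (Submodule.inclusion hD ψ)

/-- A vector-valued function that is differentiable against a dense subspace, with a derivative
that is norm continuous, is differentiable in norm: it is the integral of its derivative. -/
theorem hasDerivAt_of_inner [CompleteSpace 𝓗] {D : Submodule ℂ 𝓗} (hD : Dense (D : Set 𝓗))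
    {a b : ℝ → 𝓗} (hb : Continuous b)
    (h : ∀ φ : D, ∀ t, HasDerivAt (fun s => ⟪(φ : 𝓗), a s⟫_ℂ) ⟪(φ : 𝓗), b t⟫_ℂ t) (t : ℝ) :
    HasDerivAt a (b t) t := by
  let g : ℝ → 𝓗 := fun s => a 0 + ∫ r in (0 : ℝ)..s, b r
  have hg : ∀ t, HasDerivAt g (b t) t := fun t =>
    (hb.integral_hasStrictDerivAt 0 t).hasDerivAt.const_add _
  have hag : a = g := by
    ext1 s
    rw [← sub_eq_zero]
    refine hD.eq_zero_of_inner_right ℂ fun φ hφ => ?_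
    have hd : ∀ t, HasDerivAt (fun s => ⟪φ, a s - g s⟫_ℂ) 0 t := fun t => by
      have h1 := (h ⟨φ, hφ⟩ t).sub ((hasDerivAt_const t φ).inner ℂ (hg t))
      simpa [inner_sub_right, Pi.sub_def] using h1
    have hc := is_const_of_deriv_eq_zero (fun t => (hd t).differentiableAt)
      (fun t => (hd t).deriv) s 0
    simpa [g, inner_sub_right, inner_add_right] using hc
  rw [hag]
  exact hg t

variable {H : 𝓗 →ₗ.[ℂ] 𝓗} {U : ℝ → 𝓗 ≃ₗᵢ[ℂ] 𝓗} {D : Submodule ℂ 𝓗}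

namespace IsUnitaryGroupOf

theorem apply_zero (h : IsUnitaryGroupOf H U) (ψ : 𝓗) : U 0 ψ = ψ :=
  (U 0).injective (by rw [← h.map_add, add_zero])

theorem apply_apply_neg (h : IsUnitaryGroupOf H U) (t : ℝ) (ψ : 𝓗) : U t (U (-t) ψ) = ψ := by
  rw [← h.map_add, add_neg_cancel, h.apply_zero]

theorem inner_apply_neg (h : IsUnitaryGroupOf H U) (t : ℝ) (φ ψ : 𝓗) :
    ⟪φ, U (-t) ψ⟫_ℂ = ⟪U t φ, ψ⟫_ℂ := by
  rw [← (U t).inner_map_map, h.apply_apply_neg]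

theorem hasDerivAt (h : IsUnitaryGroupOf H U) (hD : D ≤ H.domain) {t : ℝ} {ψ : 𝓗}
    (hψ : U t ψ ∈ D) :
    HasDerivAt (fun s => U s ψ) (-(Complex.I • restrictTo H hD ⟨U t ψ, hψ⟩)) t := by
  have h1 := (h.mem_graph_iff (U t ψ) (restrictTo H hD ⟨U t ψ, hψ⟩)).1
    ((LinearPMap.mem_graph_iff H).2 ⟨⟨U t ψ, hD hψ⟩, rfl, rfl⟩)
  have h2 : HasDerivAt (fun s => U (s - t) (U t ψ)) _ t :=
    HasDerivAt.comp_sub_const t t (by rwa [sub_self])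
  simpa only [← h.map_add, sub_add_cancel] using h2

variable (hU : ∀ t, ∀ ψ ∈ D, U t ψ ∈ D)

theorem apply_heisenberg (h : IsUnitaryGroupOf H U) (A : D →ₗ[ℂ] D) (t : ℝ) (ψ : D) :
    U t (heisenberg U hU A t ψ) = A ⟨U t ψ, hU t ψ ψ.2⟩ :=
  h.apply_apply_neg t _

theorem inner_heisenberg (h : IsUnitaryGroupOf H U) (A : D →ₗ[ℂ] D) (t : ℝ) (φ : 𝓗) (ψ : D) :
    ⟪φ, heisenberg U hU A t ψ⟫_ℂ = ⟪U t φ, (A ⟨U t ψ, hU t ψ ψ.2⟩ : 𝓗)⟫_ℂ :=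
  h.inner_apply_neg t φ _

/-- A strongly continuous family of isometries maps continuous curves to continuous curves. -/
theorem continuous_apply (h : IsUnitaryGroupOf H U) {w : ℝ → 𝓗} (hw : Continuous w) :
    Continuous fun t => U t (w t) := by
  rw [continuous_iff_continuousAt]
  intro t
  have h1 : Tendsto (fun s => U s (w s - w t)) (𝓝 t) (𝓝 0) := by
    rw [tendsto_zero_iff_norm_tendsto_zero]
    simp only [LinearIsometryEquiv.norm_map]
    simpa using ((hw.sub continuous_const).norm.tendsto t : Tendsto (fun s => ‖w s - w t‖) _ _)
  have h2 := h1.add ((h.continuous (w t)).tendsto t)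
  simpa [ContinuousAt] using h2

/-- Heisenberg's equation of motion: if `[H, A] = -iB` in the sense of matrix elements between
vectors of `D`, then `A(t)` has the time derivative `B(t)`. -/
theorem isTimeDeriv_heisenberg [CompleteSpace 𝓗] (h : IsUnitaryGroupOf H U)
    (hH : IsSelfAdjoint H) (hD : D ≤ H.domain) (hdense : Dense (D : Set 𝓗)) {A B : D →ₗ[ℂ] D}
    (hA : ∀ φ ψ : D, ⟪(A φ : 𝓗), (ψ : 𝓗)⟫_ℂ = ⟪(φ : 𝓗), (A ψ : 𝓗)⟫_ℂ)
    (hcA : ∀ ψ, Continuous fun t => heisenberg U hU A t ψ)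
    (hcB : ∀ ψ, Continuous fun t => heisenberg U hU B t ψ)
    (hAB : ∀ φ ψ : D, ⟪(φ : 𝓗), restrictTo H hD (A ψ)⟫_ℂ - ⟪(A φ : 𝓗), restrictTo H hD ψ⟫_ℂ =
      -Complex.I * ⟪(φ : 𝓗), (B ψ : 𝓗)⟫_ℂ) :
    IsTimeDeriv (heisenberg U hU A) (heisenberg U hU B) := by
  intro ψ
  refine hasDerivAt_of_inner hdense (hcB ψ) fun φ t => ?_
  simp only [h.inner_heisenberg]
  set φt : D := ⟨U t φ, hU t φ φ.2⟩
  set ψt : D := ⟨U t ψ, hU t ψ ψ.2⟩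
  have hw : Continuous fun s => (A ⟨U s ψ, hU s ψ ψ.2⟩ : 𝓗) := by
    simpa only [h.apply_heisenberg] using h.continuous_apply (hcA ψ)
  -- Since `A` is symmetric, `⟪U s φ, A U s ψ⟫ = ⟪U s φ - U t φ, A U s ψ⟫ + ⟪A U t φ, U s ψ⟫`. Only
  -- the continuity of `A U s ψ` in `s` is used, not its differentiability.
  have h1 := hasDerivAt_inner_sub (h.hasDerivAt hD (hU t φ φ.2)) hw.continuousAt
  have h2 := (hasDerivAt_const t (A φt : 𝓗)).inner ℂ (h.hasDerivAt hD (hU t ψ ψ.2))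
  have h3 := h1.add h2
  refine (h3.congr_deriv ?_).congr_of_eventuallyEq (.of_forall fun s => ?_)
  · have h4 := hAB φt ψt
    rw [← inner_restrictTo_of_isSelfAdjoint hH] at h4
    simp only [inner_neg_left, inner_neg_right, inner_smul_left, inner_smul_right,
      inner_zero_left, add_zero, Complex.conj_I]
    linear_combination Complex.I * h4 - ⟪(φt : 𝓗), (B ψt : 𝓗)⟫_ℂ * Complex.I_sq
  · have h5 := hA φt ⟨U s ψ, hU s ψ ψ.2⟩
    simp only [Pi.add_apply, inner_sub_left]
    rw [h5]
    exact (sub_add_cancel _ _).symm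

end IsUnitaryGroupOf

end Evolution

/-! ### Commutators with the Hamiltonian -/

section Commutators

variable {𝓗 : Type*} [NormedAddCommGroup 𝓗] [InnerProductSpace ℂ 𝓗] [CompleteSpace 𝓗]

namespace CanonicalPair

variable (Φ : CanonicalPair 𝓗)

theorem inner_qOn (f : Test) (φ ψ : Φ.D) :
    ⟪(Φ.qOn f φ : 𝓗), (ψ : 𝓗)⟫_ℂ = ⟪(φ : 𝓗), (Φ.qOn f ψ : 𝓗)⟫_ℂ :=
  inner_restrictTo_of_isSelfAdjoint (Φ.q_selfAdjoint f) (Φ.q_dom f) φ ψ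

theorem inner_pOn (f : Test) (φ ψ : Φ.D) :
    ⟪(Φ.pOn f φ : 𝓗), (ψ : 𝓗)⟫_ℂ = ⟪(φ : 𝓗), (Φ.pOn f ψ : 𝓗)⟫_ℂ :=
  inner_restrictTo_of_isSelfAdjoint (Φ.p_selfAdjoint f) (Φ.p_dom f) φ ψ

theorem qOn_pOn (f g : Test) (ψ : Φ.D) :
    Φ.qOn f (Φ.pOn g ψ) =
      Φ.pOn g (Φ.qOn f ψ) + (Complex.I * ((∫ x, f x * g x : ℝ) : ℂ)) • ψ :=
  eq_add_of_sub_eq' (Subtype.ext (Φ.comm_q_p f g ψ))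

theorem qOn_qOn (f g : Test) (ψ : Φ.D) : Φ.qOn f (Φ.qOn g ψ) = Φ.qOn g (Φ.qOn f ψ) :=
  Subtype.ext (Φ.comm_q_q f g ψ)

theorem pOn_pOn (f g : Test) (ψ : Φ.D) : Φ.pOn f (Φ.pOn g ψ) = Φ.pOn g (Φ.pOn f ψ) :=
  Subtype.ext (Φ.comm_p_p f g ψ)

/-- The matrix elements of `q` between two vectors of `D`, as a tempered distribution. -/
noncomputable def qMatrix (φ ψ : Φ.D) : Test →L[ℝ] ℂ where
  toFun f := ⟪(φ : 𝓗), (Φ.qOn f ψ : 𝓗)⟫_ℂ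
  map_add' f g := by
    have h := LinearMap.congr_fun (Φ.q_add f g) ψ
    exact (congrArg (inner ℂ (φ : 𝓗)) h).trans (inner_add_right _ _ _)
  map_smul' a f := by
    have h := LinearMap.congr_fun (Φ.q_smul a f) ψ
    exact (congrArg (inner ℂ (φ : 𝓗)) h).trans (inner_smul_right _ _ _)
  cont := Φ.q_tempered φ ψ

/-- The matrix elements of `p` between two vectors of `D`, as a tempered distribution. -/
noncomputable def pMatrix (φ ψ : Φ.D) : Test →L[ℝ] ℂ where
  toFun f := ⟪(φ : 𝓗), (Φ.pOn f ψ : 𝓗)⟫_ℂ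
  map_add' f g := by
    have h := LinearMap.congr_fun (Φ.p_add f g) ψ
    exact (congrArg (inner ℂ (φ : 𝓗)) h).trans (inner_add_right _ _ _)
  map_smul' a f := by
    have h := LinearMap.congr_fun (Φ.p_smul a f) ψ
    exact (congrArg (inner ℂ (φ : 𝓗)) h).trans (inner_smul_right _ _ _)
  cont := Φ.p_tempered φ ψ

theorem qMatrix_apply (φ ψ : Φ.D) (f : Test) :
    Φ.qMatrix φ ψ f = ⟪(φ : 𝓗), (Φ.qOn f ψ : 𝓗)⟫_ℂ := rfl

theorem pMatrix_apply (φ ψ : Φ.D) (f : Test) :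
    Φ.pMatrix φ ψ f = ⟪(φ : 𝓗), (Φ.pOn f ψ : 𝓗)⟫_ℂ := rfl

theorem energyDensity_apply (c μ : ℝ) (ρ : Test) (x : Space) (ψ : Φ.D) :
    Φ.energyDensity c μ ρ x ψ = (1 / 2 : ℂ) •
      (Φ.pOn (translate ρ x) (Φ.pOn (translate ρ x) ψ) + ((c ^ 2 : ℝ) : ℂ) • ∑ j : Fin 3,
        Φ.qOn (-∂_{unitVec j} (translate ρ x)) (Φ.qOn (-∂_{unitVec j} (translate ρ x)) ψ) +
      ((c ^ 4 * μ ^ 2 : ℝ) : ℂ) • Φ.qOn (translate ρ x) (Φ.qOn (translate ρ x) ψ)) := by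
  simp [energyDensity]

/-- `[½ p_ρ(x)², q(f)] = -i (∫ f(y) ρ(y - x) dy) p_ρ(x)`, and the rest of the energy density
commutes with `q(f)`. -/
theorem energyDensity_qOn (c μ : ℝ) (ρ : Test) (x : Space) (f : Test) (ψ : Φ.D) :
    Φ.energyDensity c μ ρ x (Φ.qOn f ψ) - Φ.qOn f (Φ.energyDensity c μ ρ x ψ) =
      -(Complex.I * ((∫ y, f y * translate ρ x y : ℝ) : ℂ)) • Φ.pOn (translate ρ x) ψ := by
  simp only [energyDensity_apply, map_smul, map_add, map_sum, Φ.qOn_qOn f, qOn_pOn]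
  module

/-- The commutator of the energy density with `p(f)`. In the gradient term, integration by parts
moves the derivative of the commutator from the translate of `ρ` to `f`. -/
theorem energyDensity_pOn (c μ : ℝ) (ρ : Test) (x : Space) (f : Test) (ψ : Φ.D) :
    Φ.energyDensity c μ ρ x (Φ.pOn f ψ) - Φ.pOn f (Φ.energyDensity c μ ρ x ψ) =
      ((c ^ 2 : ℝ) : ℂ) • ∑ j : Fin 3,
        (Complex.I * ((∫ y, ∂_{unitVec j} f y * translate ρ x y : ℝ) : ℂ)) •
          Φ.qOn (-∂_{unitVec j} (translate ρ x)) ψ +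
      ((c ^ 4 * μ ^ 2 : ℝ) : ℂ) • (Complex.I * ((∫ y, f y * translate ρ x y : ℝ) : ℂ)) •
        Φ.qOn (translate ρ x) ψ := by
  have hparts : ∀ j, ∫ y, (-∂_{unitVec j} (translate ρ x)) y * f y =
      ∫ y, ∂_{unitVec j} f y * translate ρ x y := fun j => by
    have := SchwartzMap.integral_mul_lineDerivOp_right_eq_neg_left (μ := volume) f
      (translate ρ x) (unitVec j)
    simp only [neg_apply, neg_mul, integral_neg]
    rw [← neg_eq_iff_eq_neg.2 this]
    simp only [mul_comm]
  have hcomm : ∫ y, translate ρ x y * f y = ∫ y, f y * translate ρ x y := by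
    simp only [mul_comm]
  simp only [energyDensity_apply, map_smul, map_add, map_sum, Φ.pOn_pOn f, qOn_pOn, hparts, hcomm,
    Finset.smul_sum, Finset.sum_add_distrib, smul_add]
  simp only [Fin.sum_univ_three]
  module

/-- The commutator of the Hamiltonian with an operator `A` is the limit of the integrals of the
commutators of the smeared energy densities with `A`; the subtracted constants drop out. -/
theorem inner_commutator_of_tendsto {c μ : ℝ} {H : 𝓗 →ₗ.[ℂ] 𝓗} {hD : Φ.D ≤ H.domain}
    {ρ : ℕ → Test} {e : ℕ → ℝ} (hρ : ∀ φ ψ : Φ.D,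
      (∀ n, Integrable fun x => Φ.renormalizedDensity c μ (ρ n) (e n) φ ψ x) ∧
      Tendsto (fun n => ∫ x, Φ.renormalizedDensity c μ (ρ n) (e n) φ ψ x)
        atTop (𝓝 ⟪(φ : 𝓗), restrictTo H hD ψ⟫_ℂ))
    {A : Φ.D →ₗ[ℂ] Φ.D} (hA : ∀ φ ψ : Φ.D, ⟪(A φ : 𝓗), (ψ : 𝓗)⟫_ℂ = ⟪(φ : 𝓗), (A ψ : 𝓗)⟫_ℂ)
    (φ ψ : Φ.D) {L : ℂ}
    (hL : Tendsto (fun n => ∫ x, ⟪(φ : 𝓗), ((Φ.energyDensity c μ (ρ n) x (A ψ) -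
      A (Φ.energyDensity c μ (ρ n) x ψ) : Φ.D) : 𝓗)⟫_ℂ) atTop (𝓝 L)) :
    ⟪(φ : 𝓗), restrictTo H hD (A ψ)⟫_ℂ - ⟪(A φ : 𝓗), restrictTo H hD ψ⟫_ℂ = L := by
  refine tendsto_nhds_unique (((hρ φ (A ψ)).2.sub (hρ (A φ) ψ).2).congr fun n => ?_) hL
  rw [← integral_sub ((hρ φ (A ψ)).1 n) ((hρ (A φ) ψ).1 n)]
  refine integral_congr_ae (.of_forall fun x => ?_)
  simp only [renormalizedDensity, inner_sub_right, inner_smul_right, hA, Submodule.coe_sub]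
  ring

variable {Φ}

/-- `[H, q(f)] = -i p(f)` -/
theorem IsHamiltonian.inner_commutator_qOn {c μ : ℝ} {H : 𝓗 →ₗ.[ℂ] 𝓗}
    (h : Φ.IsHamiltonian c μ H) (hD : Φ.D ≤ H.domain) (f : Test) (φ ψ : Φ.D) :
    ⟪(φ : 𝓗), restrictTo H hD (Φ.qOn f ψ)⟫_ℂ - ⟪(Φ.qOn f φ : 𝓗), restrictTo H hD ψ⟫_ℂ =
      -Complex.I * ⟪(φ : 𝓗), (Φ.pOn f ψ : 𝓗)⟫_ℂ := by
  obtain ⟨_, ρ, e, hρ, hlim⟩ := h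
  refine Φ.inner_commutator_of_tendsto hlim (Φ.inner_qOn f) φ ψ ?_
  refine ((tendsto_integral_smeared hρ (Φ.pMatrix φ ψ) f).const_mul (-Complex.I)).congr
    fun n => ?_
  rw [← integral_const_mul]
  refine integral_congr_ae (.of_forall fun x => ?_)
  simp only [energyDensity_qOn, pMatrix_apply, Submodule.coe_smul, inner_smul_right,
    Complex.real_smul]
  ring

/-- `[H, p(f)] = -i (c² q(Δf) - c⁴ μ² q(f))` -/
theorem IsHamiltonian.inner_commutator_pOn {c μ : ℝ} {H : 𝓗 →ₗ.[ℂ] 𝓗}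
    (h : Φ.IsHamiltonian c μ H) (hD : Φ.D ≤ H.domain) (f : Test) (φ ψ : Φ.D) :
    ⟪(φ : 𝓗), restrictTo H hD (Φ.pOn f ψ)⟫_ℂ - ⟪(Φ.pOn f φ : 𝓗), restrictTo H hD ψ⟫_ℂ =
      -Complex.I * ⟪(φ : 𝓗), ((((c ^ 2 : ℝ) : ℂ) • Φ.qOn (Δ f) -
        ((c ^ 4 * μ ^ 2 : ℝ) : ℂ) • Φ.qOn f) ψ : Φ.D)⟫_ℂ := by
  obtain ⟨_, ρ, e, hρ, hlim⟩ := h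
  refine Φ.inner_commutator_of_tendsto hlim (Φ.inner_pOn f) φ ψ ?_
  let T := Φ.qMatrix φ ψ
  let T' : Fin 3 → Test →L[ℝ] ℂ := fun j =>
    T ∘L (-LineDeriv.lineDerivOpCLM ℝ Test (unitVec j))
  have hT' : ∀ j g, T' j g = T (-∂_{unitVec j} g) := fun j g => rfl
  -- `T' j` is the distribution of the matrix elements of `∂q/∂xⱼ`.
  have hΔ : T (Δ f) = -∑ j, T' j (∂_{unitVec j} f) := by
    rw [SchwartzMap.laplacian_eq_sum (EuclideanSpace.basisFun (Fin 3) ℝ)]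
    simp [hT']
  have hlim' := ((tendsto_finsetSum Finset.univ fun j _ =>
    tendsto_integral_smeared hρ (T' j) (∂_{unitVec j} f)).const_mul
      (Complex.I * ((c ^ 2 : ℝ) : ℂ))).add
    ((tendsto_integral_smeared hρ T f).const_mul (Complex.I * ((c ^ 4 * μ ^ 2 : ℝ) : ℂ)))
  convert hlim'.congr fun n => ?_ using 2
  · simp only [LinearMap.sub_apply, LinearMap.smul_apply, Submodule.coe_sub, Submodule.coe_smul,
      inner_sub_right, inner_smul_right, ← qMatrix_apply]
    change -Complex.I * (_ * T (Δ f) - _ * T f) = _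
    rw [hΔ]
    ring
  · have hi := fun j => integrable_smeared (ρ n) (T' j) (∂_{unitVec j} f)
    rw [← integral_finsetSum _ fun j _ => hi j, ← integral_const_mul, ← integral_const_mul,
      ← integral_add ((integrable_finsetSum _ fun j _ => hi j).const_mul _)
        ((integrable_smeared (ρ n) T f).const_mul _)]
    refine integral_congr_ae (.of_forall fun x => ?_)
    simp only [energyDensity_pOn, Submodule.coe_add, Submodule.coe_smul, Submodule.coe_sum,
      inner_add_right, inner_sum, inner_smul_right, Complex.real_smul, hT', ← qMatrix_apply,
      Finset.mul_sum, T]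
    congr 1
    · exact Finset.sum_congr rfl fun j _ => by ring
    · ring

end CanonicalPair

end Commutators

/-! ### The first-order equation -/

/-- The Klein-Gordon equation follows from the first-order equation, by applying it twice. -/
theorem kleinGordon_of_firstOrder {𝓗 : Type*} [NormedAddCommGroup 𝓗] [InnerProductSpace ℂ 𝓗]
    {c : ℝ} (hc : c ≠ 0) (μ : ℝ) {D : Submodule ℂ 𝓗}
    (Q : ℝ → SqrtTest (c * μ) →ₗ[ℂ] D →ₗ[ℂ] 𝓗)
    (h : ∀ u, ∃ v : ℝ → D →ₗ[ℂ] 𝓗, IsTimeDeriv (fun t => Q t u) v ∧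
      ∀ t, (1 / Complex.I) • v t + (c : ℂ) • Q t (SqrtTest.sqrtOp (c * μ) u) = 0) :
    KleinGordon c μ fun f t => Q t (SqrtTest.ofSchwartz (c * μ) f) := by
  have hderiv : ∀ u, IsTimeDeriv (fun t => Q t u)
      fun t => -(Complex.I * c) • Q t (SqrtTest.sqrtOp (c * μ) u) := fun u => by
    obtain ⟨v, hv, hveq⟩ := h u
    have : v = fun t => -(Complex.I * c) • Q t (SqrtTest.sqrtOp (c * μ) u) := by
      ext1 t
      have h1 := congrArg (Complex.I • ·) (hveq t)
      simp only [smul_add, smul_smul, smul_zero, one_div, mul_inv_cancel₀ Complex.I_ne_zero,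
        one_smul] at h1
      rw [neg_smul]
      exact eq_neg_of_add_eq_zero_left h1
    rwa [← this]
  intro f
  refine ⟨_, fun t => -(Complex.I * c) • -(Complex.I * c) •
    Q t (SqrtTest.sqrtOp (c * μ) (SqrtTest.sqrtOp (c * μ) (SqrtTest.ofSchwartz (c * μ) f))),
    hderiv _, fun ψ t => (hderiv _ ψ t).const_smul _, fun t => ?_⟩
  have hsq : SqrtTest.sqrtOp (c * μ) (SqrtTest.sqrtOp (c * μ) (SqrtTest.ofSchwartz (c * μ) f)) =
      -SqrtTest.ofSchwartz (c * μ) (Δ f) +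
        (((c * μ) ^ 2 : ℝ) : ℂ) • SqrtTest.ofSchwartz (c * μ) f := by
    ext ξ
    refine (sqrtSymbol_sq_mul_fourier (c * μ) f ξ).trans ?_
    rw [FourierTransform.fourier_add, FourierTransform.fourier_neg,
      FourierTransform.fourier_smul]
    rfl
  have hc' : (c : ℂ) ≠ 0 := by exact_mod_cast hc
  beta_reduce
  rw [hsq, map_add, map_neg, map_smul, smul_smul, smul_smul]
  have h2 : ((1 / c ^ 2 : ℝ) : ℂ) * -(Complex.I * c) * -(Complex.I * c) = -1 := by
    push_cast
    field_simp
    rw [Complex.I_sq]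
  rw [h2]
  push_cast
  module

end ScalarField

theorem theorem3 {𝓗 : Type*} [NormedAddCommGroup 𝓗] [InnerProductSpace ℂ 𝓗] [CompleteSpace 𝓗]
    (c μ : ℝ) (hc : 0 < c) :
    (∀ (Φ : CanonicalPair 𝓗) (H : 𝓗 →ₗ.[ℂ] 𝓗) (U : ℝ → 𝓗 ≃ₗᵢ[ℂ] 𝓗)
      (_ : IsSelfAdjoint H) (_ : Φ.IsHamiltonian c μ H) (_ : IsUnitaryGroupOf H U)
      (hU : ∀ t, ∀ ψ ∈ Φ.D, U t ψ ∈ Φ.D)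
      (_ : ∀ f ψ, Continuous fun t => heisenberg U hU (Φ.qOn f) t ψ)
      (_ : ∀ f ψ, Continuous fun t => heisenberg U hU (Φ.pOn f) t ψ),
      (∀ f, IsTimeDeriv (heisenberg U hU (Φ.qOn f)) (heisenberg U hU (Φ.pOn f))) ∧
      (∀ f, IsTimeDeriv (heisenberg U hU (Φ.pOn f)) fun t =>
        ((c ^ 2 : ℝ) : ℂ) • heisenberg U hU (Φ.qOn (Δ f)) t -
          ((c ^ 4 * μ ^ 2 : ℝ) : ℂ) • heisenberg U hU (Φ.qOn f) t) ∧
      KleinGordon c μ fun f => heisenberg U hU (Φ.qOn f)) ∧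
    (∀ (D : Submodule ℂ 𝓗) (Q : ℝ → SqrtTest (c * μ) →ₗ[ℂ] D →ₗ[ℂ] 𝓗),
      (∀ u, ∃ v : ℝ → D →ₗ[ℂ] 𝓗, IsTimeDeriv (fun t => Q t u) v ∧
        ∀ t, (1 / Complex.I) • v t + (c : ℂ) • Q t (SqrtTest.sqrtOp (c * μ) u) = 0) →
      KleinGordon c μ fun f t => Q t (SqrtTest.ofSchwartz (c * μ) f)) := by
  refine ⟨fun Φ H U hH hHam hUH hU hcq hcp => ?_, fun D Q h =>
    kleinGordon_of_firstOrder hc.ne' μ Q h⟩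
  obtain ⟨hD, -⟩ := id hHam
  have hq : ∀ f, IsTimeDeriv (heisenberg U hU (Φ.qOn f)) (heisenberg U hU (Φ.pOn f)) := fun f =>
    hUH.isTimeDeriv_heisenberg hU hH hD Φ.dense (Φ.inner_qOn f) (hcq f) (hcp f)
      (hHam.inner_commutator_qOn hD f)
  have hheis : ∀ f, heisenberg U hU (((c ^ 2 : ℝ) : ℂ) • Φ.qOn (Δ f) -
      ((c ^ 4 * μ ^ 2 : ℝ) : ℂ) • Φ.qOn f) = fun t =>
        ((c ^ 2 : ℝ) : ℂ) • heisenberg U hU (Φ.qOn (Δ f)) t -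
          ((c ^ 4 * μ ^ 2 : ℝ) : ℂ) • heisenberg U hU (Φ.qOn f) t := fun f => by
    ext t ψ
    simp [heisenberg]
  have hp : ∀ f, IsTimeDeriv (heisenberg U hU (Φ.pOn f)) fun t =>
      ((c ^ 2 : ℝ) : ℂ) • heisenberg U hU (Φ.qOn (Δ f)) t -
        ((c ^ 4 * μ ^ 2 : ℝ) : ℂ) • heisenberg U hU (Φ.qOn f) t := fun f => by
    rw [← hheis]
    refine hUH.isTimeDeriv_heisenberg hU hH hD Φ.dense (Φ.inner_pOn f) (hcp f) (fun ψ => ?_)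
      (hHam.inner_commutator_pOn hD f)
    rw [hheis]
    exact ((hcq (Δ f) ψ).const_smul _).sub ((hcq f ψ).const_smul _)
  refine ⟨hq, hp, fun f => ⟨_, _, hq f, hp f, fun t => ?_⟩⟩
  have hc' : (c : ℂ) ≠ 0 := by exact_mod_cast hc.ne'
  have h1 : ((1 / c ^ 2 : ℝ) : ℂ) * ((c ^ 2 : ℝ) : ℂ) = 1 := by
    push_cast
    field_simp
  have h2 : ((1 / c ^ 2 : ℝ) : ℂ) * ((c ^ 4 * μ ^ 2 : ℝ) : ℂ) = ((c ^ 2 * μ ^ 2 : ℝ) : ℂ) := by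
    push_cast
    field_simp
  rw [smul_sub, smul_smul, smul_smul, h1, h2]
  module
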